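/- **Theorem (Reliability of the forecast envelope).** Consider a two-player differential game $\dot x=f(x)+g_1(x)u_1+g_2(x)u_2$ with $x\in\mathbb R^{n_x}$, $u_j\in\mathbb R^{n_{u_j}}$, $n_{u_j}\ge 1$, and fix one player $i$. Let $\phi_V$ be a feature map with values in $\mathbb R^{p}$ and Jacobian $\nabla\phi_V(x)\in\mathbb R^{p\times n_x}$. The unknown objective of player $i$ is encoded in a reduced parameter vector $W=(W_V,W_Q,W_R^-)$, where $W_V\in\mathbb R^{p}$ are the value-function weights, $W_Q\in\mathbb R^{s}$ are the state-cost weights, and $W_R^-$ lists the entries of the input-cost matrix $R(W)\in\mathbb R^{n_{u_i}\times n_{u_i}}$ other than its $(1,1)$ entry, which has a fixed known value. Player $i$ is modelled by the feedback law $\mu_i(x;W)=-\tfrac12 R(W)^{-1}g_i(x)^\top\nabla\phi_V(x)^\top W_V$, the other player uses a fixed stationary feedback law, and the initial state $x_0$ is fixed. Let $\mathcal N(m,S)$ be the Gaussian posterior of $W$ (arbitrary mean $m$ and positive semidefinite covariance $S$), let $T\in\mathbb N$, $\Delta>0$, and let $\Gamma$ be the closed-loop map: for $\mathcal N(m,S)$-almost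 every $W$, the matrix $R(W)$ is invertible and $\Gamma(W)$ is a solution on $[0,T\Delta]$ of the closed-loop differential equation started at $x_0$, with $\phi_V$ differentiable along this solution; the states of $\Gamma(W)$ depend measurably on $W$. Write $x_t(W)=\Gamma(W)(t\Delta)$, $t=0,\dots,T$. For $\theta=(\underline x_{t,j},\overline x_{t,j})_{t=0,\dots,T;\,j=1,\dots,n_x}\in\mathbb R^d$, $d=2(T+1)n_x$, let $\mathcal X_t(\theta)=\{x\in\mathbb R^{n_x}:\underline x_{t,j}\le x_j\le\overline x_{t,j}\ \text{for } j=1,\dots,n_x\}$, and let $V(\theta)=\mathbb P_{W\sim\mathcal N(m,S)}\{\exists\, t\in\{0,\dots,T\}:\ x_t(W)\notin\mathcal X_t(\theta)\}$. Let $W^{(1)},\dots,W^{(N_{\mathrm{mc}})}$ be i.i.d. samples from $\mathcal N(m,S)$, and consider the convex scenario program $$\min_{\theta\in\mathbb R^d}\ \sum_{t=0}^{T}\sum_{j=1}^{n_x}(\overline x_{t,j}-\underline x_{t,j})\quad\text{s.t.}\quad x_t(W^{(k)})\in\mathcal X_t(\theta)\ \text{ for } k=1,\dots,N_{\mathrm{mc}},\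 t=0,\dots,T.$$ Let $\varepsilon,\beta\in(0,1)$ satisfy $$\sum_{i=0}^{d-1}\binom{N_{\mathrm{mc}}}{i}\varepsilon^i(1-\varepsilon)^{N_{\mathrm{mc}}-i}\le\beta .$$ Then the program has a solution for every realization of the samples, and for every $\theta^\star$ that depends on the samples and almost surely solves the program, the event $\{V(\theta^\star)\le\varepsilon\}$ is measurable (up to null sets) and $$\mathbb P\big(V(\theta^\star)\le\varepsilon\big)\ge 1-\beta,$$ where the probability is with respect to the draw of the $N_{\mathrm{mc}}$ samples. -/

import Mathlib

open MeasureTheory ProbabilityTheory Set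
open scoped Matrix

/-- Control-affine dynamics `ẋ = f(x) + g₁(x) u₁ + g₂(x) u₂` of a two-player differential game with
state space `ℝ^nx` and input spaces `ℝ^(nu j)`. -/
structure GameDynamics (nx : ℕ) (nu : Fin 2 → ℕ) where
  f : (Fin nx → ℝ) → (Fin nx → ℝ)
  g : ∀ j : Fin 2, (Fin nx → ℝ) → Matrix (Fin nx) (Fin (nu j)) ℝ

/-- The right-hand side `f(x) + g₁(x) u₁ + g₂(x) u₂`. -/
def GameDynamics.rhs {nx : ℕ} {nu : Fin 2 → ℕ} (G : GameDynamics nx nu)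
    (x : Fin nx → ℝ) (u : ∀ j : Fin 2, Fin (nu j) → ℝ) : Fin nx → ℝ :=
  G.f x + ∑ j, G.g j x *ᵥ u j

/-- Index set of the reduced parameter vector `W = [W_V, W_Q, W_R⁻]`: `p` value-function weights,
`s` state-cost weights and all entries of the `n × n` input-cost matrix except the first one. -/
abbrev ParamIdx (p s n : ℕ) [NeZero n] : Type :=
  Fin p ⊕ Fin s ⊕ {ab : Fin n × Fin n // ab ≠ (0, 0)}

/-- The space of reduced parameter vectors. -/
abbrev ParamSpace (p s n : ℕ) [NeZero n] : Type := EuclideanSpace ℝ (ParamIdx p s n)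

/-- The block `W_V` of the parameter vector. -/
def valueWeights {p s n : ℕ} [NeZero n] (w : ParamSpace p s n) : Fin p → ℝ :=
  fun k => w (Sum.inl k)

/-- The input-cost matrix encoded by the parameter vector; its first entry is the fixed number
`r11`, the others are read off from the block `W_R⁻`. -/
def inputCost {p s n : ℕ} [NeZero n] (r11 : ℝ) (w : ParamSpace p s n) : Matrix (Fin n) (Fin n) ℝ :=
  Matrix.of fun a b => if h : (a, b) ≠ (0, 0) then w (Sum.inr (Sum.inr ⟨(a, b), h⟩)) else r11

/-- The Jacobian matrix `∇φ(x)` of a feature map. -/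
noncomputable def featureJacobian {nx p : ℕ} (φ : (Fin nx → ℝ) → (Fin p → ℝ)) (x : Fin nx → ℝ) :
    Matrix (Fin p) (Fin nx) ℝ :=
  LinearMap.toMatrix' (fderiv ℝ φ x : (Fin nx → ℝ) →ₗ[ℝ] (Fin p → ℝ))

/-- The data of a prediction rollout: the game, the modelled player, the value features
and the fixed entry `R_[11]` of that player, the stationary feedback law of the other player, and
the initial state.  (The entry of `policy` at `player` is not used.) -/
structure PredictionModel (nx : ℕ) (nu : Fin 2 → ℕ) (p : ℕ) where
  game : GameDynamics nx nu
  player : Fin 2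
  phiV : (Fin nx → ℝ) → (Fin p → ℝ)
  r11 : ℝ
  policy : ∀ j : Fin 2, (Fin nx → ℝ) → (Fin (nu j) → ℝ)
  x0 : Fin nx → ℝ

namespace PredictionModel

variable {nx : ℕ} {nu : Fin 2 → ℕ} [∀ j, NeZero (nu j)] {p s : ℕ}

/-- The feedback law `μ(x; W) = -½ R(W)⁻¹ g(x)ᵀ ∇φ_V(x)ᵀ W_V` of the modelled player. -/
noncomputable def feedback (M : PredictionModel nx nu p) (w : ParamSpace p s (nu M.player))
    (x : Fin nx → ℝ) : Fin (nu M.player) → ℝ :=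
  (-(1 / 2) : ℝ) • ((inputCost M.r11 w)⁻¹ *ᵥ
    ((M.game.g M.player x)ᵀ *ᵥ ((featureJacobian M.phiV x)ᵀ *ᵥ valueWeights w)))

/-- The closed-loop vector field: the modelled player uses `feedback w`, the other player its own
feedback law. -/
noncomputable def closedLoopField (M : PredictionModel nx nu p)
    (w : ParamSpace p s (nu M.player)) (x : Fin nx → ℝ) : Fin nx → ℝ :=
  M.game.rhs x (Function.update (fun j => M.policy j x) M.player (M.feedback w x))

/-- `x` is a closed-loop trajectory on `[0, H]` for the parameter `w`: the feedback law makes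
sense (`R(W)` is invertible and the features are differentiable along `x`), `x` starts at
`x0`, and it solves the closed-loop differential equation on `[0, H]`. -/
def IsTrajectory (M : PredictionModel nx nu p) (H : ℝ) (w : ParamSpace p s (nu M.player))
    (x : ℝ → (Fin nx → ℝ)) : Prop :=
  IsUnit (inputCost M.r11 w) ∧ x 0 = M.x0 ∧
    ∀ t ∈ Icc (0 : ℝ) H, DifferentiableAt ℝ M.phiV (x t) ∧
      HasDerivWithinAt x (M.closedLoopField w (x t)) (Icc 0 H) t

/-- `Γ` is a closed-loop map on `[0, H]` for parameters distributed according to `P`: it sends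
`P`-almost every parameter to a closed-loop trajectory, and the state at each time of the horizon
is a random variable. -/
def IsClosedLoopMap (M : PredictionModel nx nu p) (H : ℝ)
    (P : Measure (ParamSpace p s (nu M.player)))
    (Γ : ParamSpace p s (nu M.player) → ℝ → (Fin nx → ℝ)) : Prop :=
  (∀ᵐ w ∂P, M.IsTrajectory H w (Γ w)) ∧ ∀ t ∈ Icc (0 : ℝ) H, AEMeasurable (fun w => Γ w t) P

end PredictionModel

/-- Envelope parameters `θ = (x̲, x̄)`: lower and upper bounds for each time index `t = 0, …, T` and
each state component, in total `2 (T + 1) nx` real numbers. -/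
abbrev Envelope (T nx : ℕ) : Type := (Fin (T + 1) → Fin nx → ℝ) × (Fin (T + 1) → Fin nx → ℝ)

/-- The box `X_t(θ)`. -/
def Envelope.box {T nx : ℕ} (θ : Envelope T nx) (t : Fin (T + 1)) : Set (Fin nx → ℝ) :=
  {x | ∀ j, θ.1 t j ≤ x j ∧ x j ≤ θ.2 t j}

/-- The total width of the envelope. -/
def Envelope.width {T nx : ℕ} (θ : Envelope T nx) : ℝ :=
  ∑ t, ∑ j, (θ.2 t j - θ.1 t j)

/-- `θ` is feasible for the scenario program with sampled trajectories
`x s 0, …, x s T`, `s = 1, …, N`. -/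
def Envelope.IsFeasible {N T nx : ℕ} (x : Fin N → Fin (T + 1) → Fin nx → ℝ)
    (θ : Envelope T nx) : Prop :=
  ∀ s t, x s t ∈ Envelope.box θ t

/-- `θ` solves the scenario program: it has minimal width among the envelopes containing all
sampled trajectories. -/
def Envelope.IsMinimal {N T nx : ℕ} (x : Fin N → Fin (T + 1) → Fin nx → ℝ)
    (θ : Envelope T nx) : Prop :=
  Envelope.IsFeasible x θ ∧ ∀ θ', Envelope.IsFeasible x θ' → Envelope.width θ ≤ Envelope.width θ'

/-- The trajectory produced by `Γ` for the parameter `w`, read off at the times `t · Δ`,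
`t = 0, …, T`. -/
def sampledRollout {E : Type*} {nx : ℕ} (Γ : E → ℝ → (Fin nx → ℝ)) (T : ℕ) (Δ : ℝ) (w : E) :
    Fin (T + 1) → Fin nx → ℝ :=
  fun t => Γ w ((t : ℝ) * Δ)

/-- The violation probability `V(θ)`: the probability under `P` that a trajectory leaves the
envelope at some time. -/
noncomputable def violationProb {E : Type*} [MeasurableSpace E] {T nx : ℕ} (P : Measure E)
    (Γ : E → ℝ → (Fin nx → ℝ)) (Δ : ℝ) (θ : Envelope T nx) : ℝ :=
  P.real {w | ∃ t, sampledRollout Γ T Δ w t ∉ Envelope.box θ t}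

/-! With at least one sample the scenario program has exactly one solution, the componentwise hull
of the sampled rollouts (`Envelope.IsMinimal.eq_hull`). A new rollout leaves the hull iff one of d =
2(T+1)nx scores, the coordinates and their negatives, is strictly larger than at every sample. So
everything rests on a distribution-free bound: the mass of such points exceeds ε with probability at
most P(Bin(N, ε) < d).

`pi_measure_exceedSet_gt_le_of_noTies` proves this by induction on d for atomless scores and finite
measures of mass c. Pick the sample x with the largest first score and let G be the mass above it.
Either every sample has upper mass more than e, which costs (c - e)^N, or G ≤ e and the other N - 1
samples lie in the sublevel set of x. There the claim for d - 1 scores applies with mass c - G and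
budget e - G. Since G has Lebesgue law on [0, e], integrating over x and summing over the N choices
of the top sample gives the recursion of the binomial tail.

Ties are removed by adding a vanishing multiple of an independent uniform variable; strict
inequalities survive the limit. -/

/-- The points that exceed all the points `y k` in one of the scores `f j`. -/
def exceedSet {ι κ K : Type*} (f : ι → K → ℝ) (y : κ → K) : Set K :=
  {z | ∃ j, ∀ k, f j (y k) < f j z}

/-! ### Upper mass of an atomless score: the probability integral transform -/

section Atomless

variable {K : Type*} [MeasurableSpace K]

theorem measurableSet_exceedSet_graph {ι κ : Type*} [Countable ι] [Countable κ]
    {f : ι → K → ℝ} (hf : ∀ j, Measurable (f j)) :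
    MeasurableSet {q : (κ → K) × K | q.2 ∈ exceedSet f q.1} := by
  have h : {q : (κ → K) × K | q.2 ∈ exceedSet f q.1} =
      ⋃ j, ⋂ k, {q : (κ → K) × K | f j (q.1 k) < f j q.2} := by
    ext q
    simp [exceedSet]
  rw [h]
  refine MeasurableSet.iUnion fun j => MeasurableSet.iInter fun k => ?_
  exact measurableSet_lt ((hf j).comp ((measurable_pi_apply k).comp measurable_fst))
    ((hf j).comp measurable_snd)

theorem measurableSet_exceedSet {ι κ : Type*} [Countable ι] [Countable κ]
    {f : ι → K → ℝ} (hf : ∀ j, Measurable (f j)) (y : κ → K) :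
    MeasurableSet (exceedSet f y) :=
  measurable_prodMk_left (measurableSet_exceedSet_graph hf)

theorem measurable_measureReal_prodMk_left {α : Type*} [MeasurableSpace α] (ν : Measure K)
    [SFinite ν] {s : Set (α × K)} (hs : MeasurableSet s) :
    Measurable fun x => ν.real (Prod.mk x ⁻¹' s) :=
  (measurable_measure_prodMk_left hs).ennreal_toReal

theorem measurable_measureReal_exceedSet {ι κ : Type*} [Countable ι] [Countable κ]
    (ν : Measure K) [SFinite ν] {f : ι → K → ℝ} (hf : ∀ j, Measurable (f j)) :
    Measurable fun y : κ → K => ν.real (exceedSet f y) :=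
  measurable_measureReal_prodMk_left ν (measurableSet_exceedSet_graph hf)

/-- The mass of the points with a larger score than `x`. -/
noncomputable def upperMass (ν : Measure K) (h : K → ℝ) (x : K) : ℝ := ν.real {z | h x < h z}

theorem measurable_upperMass (ν : Measure K) [SFinite ν] {h : K → ℝ} (hh : Measurable h) :
    Measurable (upperMass ν h) :=
  measurable_measureReal_prodMk_left ν
    (s := {q : K × K | h q.1 < h q.2})
    (measurableSet_lt (hh.comp measurable_fst) (hh.comp measurable_snd))

theorem tendsto_measureReal_Ioi_atTop (μ : Measure ℝ) [IsFiniteMeasure μ] :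
    Filter.Tendsto (fun t => μ.real (Ioi t)) Filter.atTop (nhds 0) := by
  have h := tendsto_measure_iInter_atTop (μ := μ) (s := fun t : ℝ => Ioi t)
    (fun t => measurableSet_Ioi.nullMeasurableSet) (fun a b hab => Ioi_subset_Ioi hab)
    ⟨0, measure_ne_top _ _⟩
  have h0 : ⋂ t : ℝ, Ioi t = ∅ := by
    ext x
    simp only [mem_iInter, mem_Ioi, mem_empty_iff_false, iff_false, not_forall, not_lt]
    exact ⟨x, le_rfl⟩
  rw [h0, measure_empty] at h
  exact (ENNReal.tendsto_toReal ENNReal.zero_ne_top).comp h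

theorem tendsto_measureReal_Ioi_atBot (μ : Measure ℝ) [IsFiniteMeasure μ] :
    Filter.Tendsto (fun t => μ.real (Ioi t)) Filter.atBot (nhds (μ.real univ)) := by
  have h := tendsto_measure_iUnion_atBot (μ := μ) (s := fun t : ℝ => Ioi t)
    (fun a b hab => Ioi_subset_Ioi hab)
  have h0 : ⋃ t : ℝ, Ioi t = univ := by
    ext x
    simp only [mem_iUnion, mem_Ioi, mem_univ, iff_true]
    exact ⟨x - 1, by linarith⟩
  rw [h0] at h
  exact (ENNReal.tendsto_toReal (measure_ne_top _ _)).comp h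

/-- Without atoms the tail function t ↦ μ(t, ∞) is continuous, so its sublevel set is a half-line
[q, ∞) whose mass is squeezed to e by approaching q from both sides. -/
theorem measureReal_setOf_measureReal_Ioi_le (μ : Measure ℝ) [IsFiniteMeasure μ]
    (hμ : ∀ a, μ {a} = 0) {e : ℝ} (he : 0 ≤ e) (hec : e ≤ μ.real univ) :
    μ.real {t | μ.real (Ioi t) ≤ e} = e := by
  set A : Set ℝ := {t | μ.real (Ioi t) ≤ e} with hA
  rcases hec.eq_or_lt with rfl | hec
  · rw [show A = univ from eq_univ_of_forall fun t => measureReal_mono (subset_univ _)]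
  have hup : ∀ s t, s ∈ A → s ≤ t → t ∈ A := fun s t hs hst =>
    (measureReal_mono (Ioi_subset_Ioi hst)).trans hs
  rcases A.eq_empty_or_nonempty with hAe | hAn
  · rw [hAe, measureReal_empty]
    -- No t has tail at most e, yet the tail tends to 0; hence e = 0.
    refine le_antisymm he ?_
    refine ge_of_tendsto (tendsto_measureReal_Ioi_atTop μ) (Filter.Eventually.of_forall fun t => ?_)
    have : t ∉ A := by simp [hAe]
    exact (not_le.1 this).le
  have hbdd : BddBelow A := by
    obtain ⟨b, hb⟩ := ((tendsto_measureReal_Ioi_atBot μ).eventually (lt_mem_nhds hec)).exists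
    refine ⟨b, fun t ht => ?_⟩
    by_contra hlt
    exact absurd (hup t b ht (not_le.1 hlt).le) (not_le.2 hb)
  set q := sInf A with hq
  have hIoi : μ.real (Ioi q) ≤ e := by
    obtain ⟨u, hmu, hu, hul⟩ := exists_seq_strictAnti_tendsto q
    have hmono : Monotone fun n => Ioi (u n) := fun a b hab =>
      Ioi_subset_Ioi (hmu.antitone hab)
    have hlim := tendsto_measure_iUnion_atTop (μ := μ) hmono
    have hun : ⋃ n, Ioi (u n) = Ioi q := by
      ext x
      simp only [mem_iUnion, mem_Ioi]
      refine ⟨fun ⟨n, hn⟩ => (hu n).trans hn, fun hx => ?_⟩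
      exact (hul.eventually (gt_mem_nhds hx)).exists
    rw [hun] at hlim
    refine le_of_tendsto ((ENNReal.tendsto_toReal (measure_ne_top _ _)).comp hlim)
      (Filter.Eventually.of_forall fun n => ?_)
    obtain ⟨a, ha, han⟩ := exists_lt_of_csInf_lt hAn (hu n)
    exact hup a _ ha han.le
  have hAeq : A = Ici q := by
    ext t
    exact ⟨fun ht => csInf_le hbdd ht, fun ht => hup q t hIoi ht⟩
  have hIciIoi : μ.real (Ici q) = μ.real (Ioi q) := by
    have : NullSingletonClass μ := ⟨hμ⟩
    exact measureReal_congr Ioi_ae_eq_Ici.symm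
  rw [hAeq]
  refine le_antisymm (hIciIoi.trans_le hIoi) ?_
  obtain ⟨u, hmu, hu, hul⟩ := exists_seq_strictMono_tendsto q
  have hanti : Antitone fun n => Ioi (u n) := fun a b hab => Ioi_subset_Ioi (hmu.monotone hab)
  have hlim := tendsto_measure_iInter_atTop (μ := μ) (s := fun n => Ioi (u n))
    (fun n => measurableSet_Ioi.nullMeasurableSet) hanti ⟨0, measure_ne_top _ _⟩
  have hun : ⋂ n, Ioi (u n) = Ici q := by
    ext x
    simp only [mem_iInter, mem_Ioi, mem_Ici]
    exact ⟨fun h => le_of_tendsto' hul fun n => (h n).le, fun hx n => (hu n).trans_le hx⟩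
  rw [hun] at hlim
  refine ge_of_tendsto ((ENNReal.tendsto_toReal (measure_ne_top _ _)).comp hlim)
    (Filter.Eventually.of_forall fun n => ?_)
  have : u n ∉ A := by rw [hAeq]; exact not_le.2 (hu n)
  exact (not_le.1 this).le

theorem measureReal_upperMass_le (ν : Measure K) [IsFiniteMeasure ν] {h : K → ℝ}
    (hh : Measurable h) (hat : ∀ a, ν {z | h z = a} = 0) {e : ℝ} (he : 0 ≤ e)
    (hec : e ≤ ν.real univ) : ν.real {x | upperMass ν h x ≤ e} = e := by
  have h1 : ∀ t, (ν.map h).real (Ioi t) = ν.real {z | t < h z} := fun t =>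
    map_measureReal_apply hh measurableSet_Ioi
  have hm : MeasurableSet {t | (ν.map h).real (Ioi t) ≤ e} := by
    have : Antitone fun t => (ν.map h).real (Ioi t) := fun a b hab =>
      measureReal_mono (Ioi_subset_Ioi hab)
    exact measurableSet_le this.measurable measurable_const
  have h2 := measureReal_setOf_measureReal_Ioi_le (ν.map h)
    (fun a => by rw [Measure.map_apply hh (measurableSet_singleton a)]; exact hat a) he
    (by rwa [map_measureReal_apply hh MeasurableSet.univ])
  rw [map_measureReal_apply hh hm] at h2
  simp only [h1] at h2
  exact h2

/-- Probability integral transform, unnormalized: both measures agree on every lower half-line. -/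
theorem map_upperMass_restrict_Iic (ν : Measure K) [IsFiniteMeasure ν] {h : K → ℝ}
    (hh : Measurable h) (hat : ∀ a, ν {z | h z = a} = 0) {e : ℝ}
    (hec : e ≤ ν.real univ) :
    (ν.map (upperMass ν h)).restrict (Iic e) = volume.restrict (Icc 0 e) := by
  refine Measure.ext_of_Iic _ _ fun a => ?_
  rw [Measure.restrict_apply measurableSet_Iic, Measure.restrict_apply measurableSet_Iic,
    Iic_inter_Iic, Measure.map_apply (measurable_upperMass ν hh) measurableSet_Iic,
    show Iic a ∩ Icc 0 e = Icc 0 (a ⊓ e) from by ext x; simp; tauto, Real.volume_Icc, sub_zero]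
  set b := a ⊓ e
  rcases le_or_gt 0 b with hb | hb
  · rw [show upperMass ν h ⁻¹' Iic b = {x | upperMass ν h x ≤ b} from rfl,
      ← ofReal_measureReal, measureReal_upperMass_le ν hh hat hb (inf_le_right.trans hec)]
  · rw [ENNReal.ofReal_of_nonpos hb.le]
    convert measure_empty (μ := ν)
    ext x
    simp only [mem_preimage, mem_Iic, mem_empty_iff_false, iff_false, not_le]
    exact hb.trans_le measureReal_nonneg

theorem setLIntegral_sub_upperMass_pow (ν : Measure K) [IsFiniteMeasure ν] {h : K → ℝ}
    (hh : Measurable h) (hat : ∀ a, ν {z | h z = a} = 0) {e : ℝ} (he : 0 ≤ e)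
    (hec : e ≤ ν.real univ) (i : ℕ) :
    ∫⁻ x in {x | upperMass ν h x ≤ e}, ENNReal.ofReal ((e - upperMass ν h x) ^ i) ∂ν =
      ENNReal.ofReal (e ^ (i + 1) / (i + 1)) := by
  have hG := measurable_upperMass ν hh
  have h1 : ∫⁻ x in {x | upperMass ν h x ≤ e}, ENNReal.ofReal ((e - upperMass ν h x) ^ i) ∂ν =
      ∫⁻ u in Iic e, ENNReal.ofReal ((e - u) ^ i) ∂(ν.map (upperMass ν h)) := by
    rw [setLIntegral_map measurableSet_Iic (by fun_prop) hG]
    rfl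
  rw [h1, map_upperMass_restrict_Iic ν hh hat hec, ← ofReal_integral_eq_lintegral_ofReal]
  · congr 1
    rw [integral_Icc_eq_integral_Ioc, ← intervalIntegral.integral_of_le he,
      intervalIntegral.integral_comp_sub_left (fun u => u ^ i) e, integral_pow]
    simp
  · exact (by fun_prop : Continuous fun u : ℝ => (e - u) ^ i).continuousOn.integrableOn_Icc
  · filter_upwards [ae_restrict_mem measurableSet_Icc] with u hu
    exact pow_nonneg (sub_nonneg.2 hu.2) i

end Atomless

/-! ### Binomial tail recursion and the coverage bound without ties -/

section Core

variable {K : Type*} [MeasurableSpace K]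

/-- The lower tail of the binomial distribution, homogenized to total mass `c`. -/
def binomialTail (d N : ℕ) (e c : ℝ) : ℝ :=
  ∑ i ∈ Finset.range d, (N.choose i : ℝ) * e ^ i * (c - e) ^ (N - i)

/-- The shape that peeling produces: no sample in the top mass e, or one of n + 1 samples on top
with the lower-order terms integrated. It rests on (n+1) C(n,i) = (i+1) C(n+1,i+1). -/
theorem binomialTail_succ_succ (d n : ℕ) (e c : ℝ) :
    binomialTail (d + 1) (n + 1) e c = (c - e) ^ (n + 1) + (n + 1 : ℝ) *
      ∑ i ∈ Finset.range d, (n.choose i : ℝ) * (c - e) ^ (n - i) * (e ^ (i + 1) / (i + 1)) := by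
  rw [binomialTail, Finset.sum_range_succ', Finset.mul_sum, add_comm]
  congr 1
  · simp
  · refine Finset.sum_congr rfl fun i _ => ?_
    have h : ((n + 1 : ℕ) : ℝ) * n.choose i = (n + 1).choose (i + 1) * (i + 1 : ℕ) := by
      exact_mod_cast Nat.add_one_mul_choose_eq n i
    have hi : ((i : ℝ) + 1) ≠ 0 := by positivity
    rw [Nat.add_sub_add_right]
    push_cast at h
    field_simp
    linear_combination -(e ^ (i + 1) * (c - e) ^ (n - i)) * h

/-- Mass and budget shrink by the same amount G, so c - e is constant and only the powers of e - G
are integrated. -/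
theorem setLIntegral_binomialTail_upperMass (ν : Measure K) [IsFiniteMeasure ν] {h : K → ℝ}
    (hh : Measurable h) (hat : ∀ a, ν {z | h z = a} = 0) {e : ℝ} (he : 0 ≤ e)
    (hec : e ≤ ν.real univ) (d n : ℕ) :
    ∫⁻ x in {x | upperMass ν h x ≤ e}, ENNReal.ofReal
        (binomialTail d n (e - upperMass ν h x) (ν.real univ - upperMass ν h x)) ∂ν =
      ENNReal.ofReal (∑ i ∈ Finset.range d,
        (n.choose i : ℝ) * (ν.real univ - e) ^ (n - i) * (e ^ (i + 1) / (i + 1))) := by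
  have hG := measurable_upperMass ν hh
  have hc : 0 ≤ ν.real univ - e := sub_nonneg.2 hec
  have h1 : ∀ x ∈ {x | upperMass ν h x ≤ e}, ENNReal.ofReal
      (binomialTail d n (e - upperMass ν h x) (ν.real univ - upperMass ν h x)) =
      ∑ i ∈ Finset.range d, ENNReal.ofReal ((n.choose i : ℝ) * (ν.real univ - e) ^ (n - i)) *
        ENNReal.ofReal ((e - upperMass ν h x) ^ i) := by
    intro x hx
    have hx' : 0 ≤ e - upperMass ν h x := sub_nonneg.2 hx
    rw [binomialTail, ENNReal.ofReal_sum_of_nonneg]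
    · refine Finset.sum_congr rfl fun i _ => ?_
      rw [← ENNReal.ofReal_mul (by positivity), sub_sub_sub_cancel_right]
      congr 1
      ring
    · intro i _
      rw [sub_sub_sub_cancel_right]
      positivity
  rw [setLIntegral_congr_fun (measurableSet_le hG measurable_const) h1, lintegral_finsetSum,
    ENNReal.ofReal_sum_of_nonneg]
  · refine Finset.sum_congr rfl fun i _ => ?_
    rw [lintegral_const_mul _ (by fun_prop), setLIntegral_sub_upperMass_pow ν hh hat he hec,
      ← ENNReal.ofReal_mul (by positivity)]
  · intro i _
    positivity
  · intro i _
    fun_prop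

/-- The coverage bound for scores without ties, by peeling off the first score. -/
theorem pi_measure_exceedSet_gt_le_of_noTies (d : ℕ) :
    ∀ (N : ℕ) (ν : Measure K) [IsFiniteMeasure ν] (f : Fin d → K → ℝ)
      (_ : ∀ j, Measurable (f j)) (_ : ∀ j a, ν {z | f j z = a} = 0) (e : ℝ)
      (_ : 0 ≤ e) (_ : e ≤ ν.real univ),
      Measure.pi (fun _ : Fin N => ν) {y | e < ν.real (exceedSet f y)} ≤
        ENNReal.ofReal (binomialTail d N e (ν.real univ)) := by
  induction d with
  | zero =>
    intro N ν _ f _ _ e he _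
    have h : {y : Fin N → K | e < ν.real (exceedSet f y)} = ∅ := by
      ext y
      simp [exceedSet, he]
    rw [h, measure_empty]
    exact zero_le
  | succ d ih =>
    intro N ν _ f hf hat e he hec
    cases N with
    | zero =>
      -- With no samples the bound is the trivial 1, the total mass of the empty product, whatever
      -- the mass of ν.
      have h1 : binomialTail (d + 1) 0 e (ν.real univ) = 1 := by
        rw [binomialTail, Finset.sum_eq_single 0] <;> simp +contextual [Nat.choose_eq_zero_iff]
        intro b _ hb
        exact Or.inl (Nat.pos_of_ne_zero hb)
      rw [h1, ENNReal.ofReal_one]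
      refine (measure_mono (subset_univ _)).trans ?_
      simp
    | succ n =>
      set h : K → ℝ := f 0 with hh0
      set f' : Fin d → K → ℝ := fun j => f j.succ with hf'
      have hh : Measurable h := hf 0
      have hf'm : ∀ j, Measurable (f' j) := fun j => hf j.succ
      set G := upperMass ν h with hGdef
      have hG : Measurable G := measurable_upperMass ν hh
      let L : K → Set K := fun x => {z | h z ≤ h x}
      have hL : ∀ x, MeasurableSet (L x) := fun x => measurableSet_le hh measurable_const
      have hLmass : ∀ x, (ν.restrict (L x)).real univ = ν.real univ - G x := by
        intro x
        rw [measureReal_restrict_apply_univ, eq_sub_iff_add_eq]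
        have : {z | h x < h z} = (L x)ᶜ := by
          ext z
          simp [L]
        rw [hGdef, upperMass, this, measureReal_add_measureReal_compl (hL x)]
      let V : K → (Fin n → K) → ℝ := fun x y => (ν.restrict (L x)).real (exceedSet f' y)
      have hVm : Measurable fun q : K × (Fin n → K) => V q.1 q.2 := by
        have : ∀ q : K × (Fin n → K), V q.1 q.2 = ν.real (Prod.mk q ⁻¹'
            ({r : (K × (Fin n → K)) × K | r.2 ∈ exceedSet f' r.1.2} ∩
              {r | h r.2 ≤ h r.1.1})) := by
          intro q
          exact measureReal_restrict_apply (measurableSet_exceedSet hf'm q.2)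
        simp only [this]
        refine measurable_measureReal_prodMk_left ν (MeasurableSet.inter ?_ ?_)
        · exact ((measurable_snd.comp measurable_fst).prodMk measurable_snd)
            (measurableSet_exceedSet_graph hf'm)
        · exact measurableSet_le (hh.comp measurable_snd)
            (hh.comp (measurable_fst.comp measurable_fst))
      -- The bad event with `q.1` as top sample and `q.2` as the others; G + V bounds the exceeding
      -- mass by splitting it at the first score of `q.1`.
      let D : Set (K × (Fin n → K)) :=
        ({q | G q.1 ≤ e} ∩ {q | ∀ l, h (q.2 l) ≤ h q.1}) ∩ {q | e < G q.1 + V q.1 q.2}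
      have hD : MeasurableSet D := by
        refine (MeasurableSet.inter ?_ ?_).inter ?_
        · exact measurableSet_le (hG.comp measurable_fst) measurable_const
        · have : {q : K × (Fin n → K) | ∀ l, h (q.2 l) ≤ h q.1} =
              ⋂ l, {q | h (q.2 l) ≤ h q.1} := by
            ext q
            simp
          rw [this]
          exact MeasurableSet.iInter fun l => measurableSet_le
            (hh.comp ((measurable_pi_apply l).comp measurable_snd)) (hh.comp measurable_fst)
        · exact measurableSet_lt measurable_const ((hG.comp measurable_fst).add hVm)
      have hsub : {y : Fin (n + 1) → K | e < ν.real (exceedSet f y)} ⊆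
          (univ.pi fun _ => {x | e < G x}) ∪
            ⋃ k, MeasurableEquiv.piFinSuccAbove (fun _ => K) k ⁻¹' D := by
        intro y hy
        by_cases hall : ∀ k, e < G (y k)
        · exact Or.inl fun k _ => hall k
        right
        obtain ⟨k, hk⟩ := Finite.exists_max fun k => h (y k)
        refine mem_iUnion.2 ⟨k, ?_⟩
        refine ⟨⟨?_, fun l => hk _⟩, ?_⟩
        · obtain ⟨l, hl⟩ := not_forall.1 hall
          refine le_trans ?_ (not_lt.1 hl)
          exact measureReal_mono fun z hz => (hk l).trans_lt hz
        · refine lt_of_lt_of_le (show e < ν.real (exceedSet f y) from hy) ?_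
          change _ ≤ ν.real {z | h (y k) < h z} +
            (ν.restrict (L (y k))).real (exceedSet f' fun l => y (k.succAbove l))
          rw [measureReal_restrict_apply (measurableSet_exceedSet hf'm _)]
          -- A point not above the top sample cannot exceed through the first score, and dropping
          -- that sample only enlarges the rest.
          refine (measureReal_mono ?_).trans (measureReal_union_le _ _)
          rintro z ⟨j, hj⟩
          by_cases hz : h (y k) < h z
          · exact Or.inl hz
          · refine Or.inr ⟨?_, not_lt.1 hz⟩
            cases j using Fin.cases with
            | zero => exact absurd (hj k) hz
            | succ j => exact ⟨j, fun l => hj _⟩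
      have hnone : Measure.pi (fun _ : Fin (n + 1) => ν) (univ.pi fun _ => {x | e < G x}) =
          ENNReal.ofReal ((ν.real univ - e) ^ (n + 1)) := by
        have hcompl : {x | e < G x} = {x | G x ≤ e}ᶜ := by
          ext x
          simp
        have hreal : ν.real {x | e < G x} = ν.real univ - e := by
          rw [hcompl, measureReal_compl (measurableSet_le hG measurable_const),
            measureReal_upperMass_le ν hh (hat 0) he hec]
        rw [Measure.pi_pi, Finset.prod_const, Finset.card_univ, Fintype.card_fin,
          ENNReal.ofReal_pow (sub_nonneg.2 hec), ← hreal, ofReal_measureReal]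
      have hDle : (ν.prod (Measure.pi fun _ : Fin n => ν)) D ≤
          ENNReal.ofReal (∑ i ∈ Finset.range d,
            (n.choose i : ℝ) * (ν.real univ - e) ^ (n - i) * (e ^ (i + 1) / (i + 1))) := by
        rw [Measure.prod_apply hD, ← setLIntegral_binomialTail_upperMass ν hh (hat 0) he hec,
          ← lintegral_indicator (measurableSet_le hG measurable_const)]
        refine lintegral_mono fun x => ?_
        by_cases hx : G x ≤ e
        · rw [indicator_of_mem (show x ∈ {x | G x ≤ e} from hx), ← hLmass x]
          have hpre : Prod.mk x ⁻¹' D ⊆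
              {y | e - G x < V x y} ∩ univ.pi fun _ => L x := by
            rintro y ⟨⟨_, hy⟩, hy'⟩
            refine ⟨?_, fun l _ => hy l⟩
            exact sub_lt_iff_lt_add'.2 (show e < G x + V x y from hy')
          refine (measure_mono hpre).trans ?_
          have hVx : MeasurableSet {y | e - G x < V x y} :=
            measurableSet_lt measurable_const (hVm.comp measurable_prodMk_left)
          -- Confining the other samples to `L x` leaves a product of restricted, unnormalized
          -- measures; this is why the induction runs over finite measures.
          rw [← Measure.restrict_apply hVx, Measure.restrict_pi_pi]
          refine ih n (ν.restrict (L x)) f' hf'm (fun j a => ?_) _ (sub_nonneg.2 hx) ?_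
          · exact nonpos_iff_eq_zero.1
              ((Measure.restrict_apply_le _ _).trans_eq (hat j.succ a))
          · rw [hLmass]
            linarith
        · have : Prod.mk x ⁻¹' D = ∅ := by
            ext y
            exact ⟨fun hy => hx hy.1.1, fun hy => hy.elim⟩
          rw [this, measure_empty]
          exact zero_le
      refine (measure_mono hsub).trans ((measure_union_le _ _).trans ?_)
      rw [hnone, binomialTail_succ_succ, ENNReal.ofReal_add (pow_nonneg (sub_nonneg.2 hec) _)]
      · refine add_le_add le_rfl ((measure_iUnion_fintype_le _ _).trans ?_)
        have hk : ∀ k : Fin (n + 1), Measure.pi (fun _ : Fin (n + 1) => ν)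
            (MeasurableEquiv.piFinSuccAbove (fun _ => K) k ⁻¹' D) =
            (ν.prod (Measure.pi fun _ : Fin n => ν)) D := fun k =>
          (measurePreserving_piFinSuccAbove (fun _ : Fin (n + 1) => ν) k).measure_preimage
            hD.nullMeasurableSet
        simp only [hk, Finset.sum_const, Finset.card_univ, Fintype.card_fin, nsmul_eq_mul]
        rw [ENNReal.ofReal_mul (by positivity)]
        gcongr
        rw [show (n + 1 : ℝ) = ((n + 1 : ℕ) : ℝ) by push_cast; rfl, ENNReal.ofReal_natCast]
      · have := sub_nonneg.2 hec
        positivity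

end Core

/-! ### Breaking ties by a random perturbation -/

section Ties

/-- Fatou for sets: the lower limit is an increasing union of tail intersections. -/
theorem eventually_lt_measure_of_lt_measure_eventually {α : Type*} [MeasurableSpace α]
    {μ : Measure α} {A : ℕ → Set α} {C : ENNReal}
    (h : C < μ {x | ∀ᶠ m in Filter.atTop, x ∈ A m}) :
    ∀ᶠ m in Filter.atTop, C < μ (A m) := by
  have hU : {x | ∀ᶠ m in Filter.atTop, x ∈ A m} = ⋃ n, ⋂ m ≥ n, A m := by
    ext x
    simp
  have hmono : Monotone fun n => ⋂ m ≥ n, A m := fun a b hab =>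
    iInter₂_mono' fun m hm => ⟨m, hab.trans hm, subset_rfl⟩
  rw [hU] at h
  obtain ⟨n, hn⟩ := ((tendsto_measure_iUnion_atTop (μ := μ) hmono).eventually
    (lt_mem_nhds h)).exists
  filter_upwards [Filter.eventually_ge_atTop n] with m hm
  exact hn.trans_le (measure_mono (iInter₂_subset m hm))

/-- The score `f` with ties broken by a small multiple of an independent real number. -/
noncomputable def perturbedScore {ι K : Type*} (f : ι → K → ℝ) (m : ℕ) (j : ι) (q : K × ℝ) : ℝ :=
  f j q.1 + q.2 / (m + 1)

theorem eventually_mem_exceedSet_perturbedScore {ι κ K : Type*} [Finite κ] (f : ι → K → ℝ)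
    (y : κ → K × ℝ) {q : K × ℝ} (hq : q.1 ∈ exceedSet f fun k => (y k).1) :
    ∀ᶠ m in Filter.atTop, q ∈ exceedSet (perturbedScore f m) y := by
  obtain ⟨j, hj⟩ := hq
  have hlim : ∀ r : K × ℝ, Filter.Tendsto (fun m => perturbedScore f m j r) Filter.atTop
      (nhds (f j r.1)) := by
    intro r
    have : Filter.Tendsto (fun m : ℕ => r.2 / ((m : ℝ) + 1)) Filter.atTop (nhds 0) :=
      (tendsto_const_div_atTop_nhds_zero_nat r.2).comp (Filter.tendsto_add_atTop_nat 1) |>.congr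
        fun m => by simp
    simpa [perturbedScore] using this.const_add (f j r.1)
  have : ∀ᶠ m in Filter.atTop, ∀ k, perturbedScore f m j (y k) < perturbedScore f m j q :=
    Filter.eventually_all.2 fun k => (hlim (y k)).eventually_lt (hlim q) (hj k)
  exact this.mono fun m hm => ⟨j, hm⟩

variable {K : Type*} [MeasurableSpace K]

theorem measurable_perturbedScore {ι : Type*} {f : ι → K → ℝ} (hf : ∀ j, Measurable (f j))
    (m : ℕ) (j : ι) : Measurable (perturbedScore f m j) :=
  ((hf j).comp measurable_fst).add (measurable_snd.div_const _)

/-- Fubini: for each fixed point, a single value of the perturbation hits the level a. -/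
theorem measure_perturbedScore_eq {ι : Type*} {f : ι → K → ℝ} (hf : ∀ j, Measurable (f j))
    (m : ℕ) (j : ι) (ν : Measure K) [SFinite ν] (U : Measure ℝ) [SFinite U]
    [NullSingletonClass U] (a : ℝ) : (ν.prod U) {q | perturbedScore f m j q = a} = 0 := by
  have hm : MeasurableSet {q | perturbedScore f m j q = a} :=
    measurable_perturbedScore hf m j (measurableSet_singleton a)
  rw [Measure.measure_prod_null hm]
  refine Filter.Eventually.of_forall fun z => ?_
  refine measure_mono_null (t := {(a - f j z) * (m + 1)}) ?_ (measure_singleton _)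
  intro u hu
  have hu' : f j z + u / (m + 1) = a := hu
  have hm0 : (m : ℝ) + 1 ≠ 0 := by positivity
  rw [mem_singleton_iff, ← hu']
  field_simp
  ring

/-- **Coverage bound.** For `N` independent samples from `ν` and `d` scores, the `ν`-mass of the
points exceeding all samples in some score is at most `e`, except with the probability that
a binomial variable with parameters `N` and `e` is less than `d`. -/
theorem pi_measure_exceedSet_gt_le (d N : ℕ) (ν : Measure K) [IsProbabilityMeasure ν]
    (f : Fin d → K → ℝ) (hf : ∀ j, Measurable (f j)) {e : ℝ} (he : 0 ≤ e) (he1 : e ≤ 1) :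
    Measure.pi (fun _ : Fin N => ν) {y | e < ν.real (exceedSet f y)} ≤
      ENNReal.ofReal (binomialTail d N e 1) := by
  let U : Measure ℝ := volume.restrict (Icc 0 1)
  have : IsProbabilityMeasure U := ⟨by simp [U]⟩
  let A : ℕ → Set (Fin N → K × ℝ) := fun m =>
    {y | e < (ν.prod U).real (exceedSet (perturbedScore f m) y)}
  have hA : ∀ m, Measure.pi (fun _ : Fin N => ν.prod U) (A m) ≤
      ENNReal.ofReal (binomialTail d N e 1) := by
    intro m
    have h := pi_measure_exceedSet_gt_le_of_noTies d N (ν.prod U) (perturbedScore f m)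
      (measurable_perturbedScore hf m) (fun j a => measure_perturbedScore_eq hf m j ν U a) e he
      (by simpa using he1)
    rwa [probReal_univ] at h
  have hfst : MeasurePreserving (Prod.fst : K × ℝ → K) (ν.prod U) ν := measurePreserving_fst
  have hpi : MeasurePreserving (fun (y : Fin N → K × ℝ) k => (y k).1)
      (Measure.pi fun _ : Fin N => ν.prod U) (Measure.pi fun _ : Fin N => ν) :=
    measurePreserving_pi _ _ fun _ => hfst
  have hE : MeasurableSet {y : Fin N → K | e < ν.real (exceedSet f y)} :=
    measurableSet_lt measurable_const (measurable_measureReal_exceedSet ν hf)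
  rw [← hpi.measure_preimage hE.nullMeasurableSet]
  -- Fatou is used twice: over test points for fixed samples, then over the samples, which would
  -- give some m violating the tie-free bound.
  by_contra hcon
  have hsub : (fun (y : Fin N → K × ℝ) k => (y k).1) ⁻¹'
      {y | e < ν.real (exceedSet f y)} ⊆ {y | ∀ᶠ m in Filter.atTop, y ∈ A m} := by
    intro y hy
    have hy' : ENNReal.ofReal e < ν (exceedSet f fun k => (y k).1) :=
      (ENNReal.ofReal_lt_iff_lt_toReal he (measure_ne_top _ _)).2 hy
    rw [← hfst.measure_preimage (measurableSet_exceedSet hf _).nullMeasurableSet] at hy'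
    have hev := eventually_lt_measure_of_lt_measure_eventually (hy'.trans_le (measure_mono
      fun q hq => eventually_mem_exceedSet_perturbedScore f y hq))
    exact hev.mono fun m hm => (ENNReal.ofReal_lt_iff_lt_toReal he (measure_ne_top _ _)).1 hm
  obtain ⟨m, hm⟩ := (eventually_lt_measure_of_lt_measure_eventually
    ((not_le.1 hcon).trans_le (measure_mono hsub))).exists
  exact absurd (hA m) (not_le.2 hm)

end Ties

/-! ### The scenario program and its unique solution -/

section Hull

/-- The componentwise minimum and maximum of the sampled trajectories. -/
noncomputable def Envelope.hull {N T nx : ℕ} (x : Fin N → Fin (T + 1) → Fin nx → ℝ) :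
    Envelope T nx :=
  (fun t j => ⨅ k, x k t j, fun t j => ⨆ k, x k t j)

variable {N T nx : ℕ} {x : Fin N → Fin (T + 1) → Fin nx → ℝ} {θ : Envelope T nx}

theorem Envelope.isFeasible_hull : Envelope.IsFeasible x (Envelope.hull x) := fun k t j =>
  ⟨ciInf_le (f := fun k => x k t j) (finite_range _).bddBelow k,
    le_ciSup (f := fun k => x k t j) (finite_range _).bddAbove k⟩

theorem Envelope.IsFeasible.fst_le_hull [Nonempty (Fin N)] (h : Envelope.IsFeasible x θ)
    (t : Fin (T + 1)) (j : Fin nx) : θ.1 t j ≤ (Envelope.hull x).1 t j :=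
  le_ciInf fun k => (h k t j).1

theorem Envelope.IsFeasible.hull_le_snd [Nonempty (Fin N)] (h : Envelope.IsFeasible x θ)
    (t : Fin (T + 1)) (j : Fin nx) : (Envelope.hull x).2 t j ≤ θ.2 t j :=
  ciSup_le fun k => (h k t j).2

theorem Envelope.isMinimal_hull [Nonempty (Fin N)] : Envelope.IsMinimal x (Envelope.hull x) :=
  ⟨Envelope.isFeasible_hull, fun _ h => Finset.sum_le_sum fun t _ => Finset.sum_le_sum fun j _ =>
    sub_le_sub (h.hull_le_snd t j) (h.fst_le_hull t j)⟩

/-- Every feasible envelope contains the hull face by face, so equal total width forces equality of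
each width, hence of each face. -/
theorem Envelope.IsMinimal.eq_hull [Nonempty (Fin N)] (h : Envelope.IsMinimal x θ) :
    θ = Envelope.hull x := by
  have hle : ∀ t j, (Envelope.hull x).2 t j - (Envelope.hull x).1 t j ≤ θ.2 t j - θ.1 t j :=
    fun t j => sub_le_sub (h.1.hull_le_snd t j) (h.1.fst_le_hull t j)
  have hsum := le_antisymm (h.2 _ Envelope.isFeasible_hull)
    ((Envelope.isMinimal_hull (x := x)).2 θ h.1)
  have heq : ∀ t j, (Envelope.hull x).2 t j - (Envelope.hull x).1 t j = θ.2 t j - θ.1 t j := by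
    intro t j
    have ht := (Finset.sum_eq_sum_iff_of_le fun t _ => Finset.sum_le_sum fun j _ => hle t j).1
      hsum.symm t (Finset.mem_univ t)
    exact (Finset.sum_eq_sum_iff_of_le fun j _ => hle t j).1 ht j (Finset.mem_univ j)
  refine Prod.ext ?_ ?_ <;> funext t j
  · linarith [heq t j, h.1.hull_le_snd t j, h.1.fst_le_hull t j]
  · linarith [heq t j, h.1.hull_le_snd t j, h.1.fst_le_hull t j]

/-- The coordinates of a trajectory and their negatives, one score for each face of the boxes. -/
def faceScore {E : Type*} {T nx : ℕ} (X : E → Fin (T + 1) → Fin nx → ℝ)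
    (i : Bool × Fin (T + 1) × Fin nx) (w : E) : ℝ :=
  bif i.1 then X w i.2.1 i.2.2 else -X w i.2.1 i.2.2

/-- Each face of the hull is attained by some sample, so crossing it means beating all samples
strictly in that face's score. -/
theorem mem_exceedSet_faceScore_iff {E : Type*} [Nonempty (Fin N)]
    (X : E → Fin (T + 1) → Fin nx → ℝ) (W : Fin N → E) (w : E) :
    w ∈ exceedSet (faceScore X) W ↔
      ∃ t, X w t ∉ Envelope.box (Envelope.hull fun k => X (W k)) t := by
  constructor
  · rintro ⟨⟨b, t, j⟩, h⟩
    refine ⟨t, fun hbox => ?_⟩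
    obtain ⟨h1, h2⟩ := hbox j
    cases b
    · obtain ⟨k, hk⟩ := exists_eq_ciInf_of_finite (f := fun k => X (W k) t j)
      have hlt : -X (W k) t j < -X w t j := h k
      change (⨅ k, X (W k) t j) ≤ X w t j at h1
      rw [← hk] at h1
      linarith
    · obtain ⟨k, hk⟩ := exists_eq_ciSup_of_finite (f := fun k => X (W k) t j)
      have hlt : X (W k) t j < X w t j := h k
      change X w t j ≤ ⨆ k, X (W k) t j at h2
      rw [← hk] at h2
      linarith
  · rintro ⟨t, ht⟩
    obtain ⟨j, hj⟩ := not_forall.1 ht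
    have hf := fun k => Envelope.isFeasible_hull (x := fun k => X (W k)) k t j
    rcases not_and_or.1 hj with h | h
    · exact ⟨(false, t, j), fun k => neg_lt_neg ((not_le.1 h).trans_le (hf k).1)⟩
    · exact ⟨(true, t, j), fun k => (hf k).2.trans_lt (not_le.1 h)⟩

end Hull

/-! ### From the coverage bound to the envelope -/

section Reliability

theorem exceedSet_comp_of_surjective {ι ι' κ K : Type*} (f : ι → K → ℝ) {g : ι' → ι}
    (hg : g.Surjective) (y : κ → K) : exceedSet (fun i => f (g i)) y = exceedSet f y := by
  ext z
  exact (hg.exists (p := fun j => ∀ k, f j (y k) < f j z)).symm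

theorem measurable_faceScore {E : Type*} [MeasurableSpace E] {T nx : ℕ}
    {X : E → Fin (T + 1) → Fin nx → ℝ} (hX : Measurable X) (i : Bool × Fin (T + 1) × Fin nx) :
    Measurable (faceScore X i) := by
  obtain ⟨b, t, j⟩ := i
  have h : Measurable fun w => X w t j := by fun_prop
  cases b
  · exact h.neg
  · exact h

/-- Uniqueness makes the violation probability of any almost sure solution agree almost surely with
a measurable function of the samples, although `θstar` need not be measurable. -/
theorem violationProb_reliability {E : Type*} [MeasurableSpace E] (P : Measure E)
    [IsProbabilityMeasure P] {N T nx : ℕ} [Nonempty (Fin N)] (Γ : E → ℝ → (Fin nx → ℝ)) (Δ : ℝ)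
    (hX : AEMeasurable (sampledRollout Γ T Δ) P) {ε β : ℝ} (hε : 0 ≤ ε) (hε1 : ε ≤ 1)
    (hN : binomialTail (2 * (T + 1) * nx) N ε 1 ≤ β) (hβ : 0 ≤ β)
    (θstar : (Fin N → E) → Envelope T nx)
    (hθ : ∀ᵐ W ∂(Measure.pi fun _ : Fin N => P),
      Envelope.IsMinimal (fun k => sampledRollout Γ T Δ (W k)) (θstar W)) :
    NullMeasurableSet {W | violationProb P Γ Δ (θstar W) ≤ ε} (Measure.pi fun _ : Fin N => P) ∧
      1 - β ≤ (Measure.pi fun _ : Fin N => P).real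
        {W | violationProb P Γ Δ (θstar W) ≤ ε} := by
  set Q := Measure.pi fun _ : Fin N => P with hQ
  -- The rollout is only a.e. measurable; the scores are built from a measurable version.
  set X := hX.mk with hXdef
  have hXm : Measurable X := hX.measurable_mk
  have hXae : sampledRollout Γ T Δ =ᵐ[P] X := hX.ae_eq_mk
  have hfm := measurable_faceScore hXm
  have hV : ∀ᵐ W ∂Q, violationProb P Γ Δ (θstar W) = P.real (exceedSet (faceScore X) W) := by
    have hXpi := Measure.ae_eq_pi (μ := fun _ : Fin N => P) fun _ => hXae
    filter_upwards [hθ, hXpi] with W hW hWX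
    have hWX' : (fun k => sampledRollout Γ T Δ (W k)) = fun k => X (W k) := hWX
    rw [hW.eq_hull, hWX']
    refine measureReal_congr ?_
    filter_upwards [hXae] with w hw
    refine propext (Iff.trans ?_ (mem_exceedSet_faceScore_iff X W w).symm)
    change (∃ t, sampledRollout Γ T Δ w t ∉ _) ↔ _
    rw [hw]
  have hmeas : MeasurableSet {W : Fin N → E | P.real (exceedSet (faceScore X) W) ≤ ε} :=
    measurableSet_le (measurable_measureReal_exceedSet P hfm) measurable_const
  have hset : {W | violationProb P Γ Δ (θstar W) ≤ ε} =ᵐ[Q]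
      {W | P.real (exceedSet (faceScore X) W) ≤ ε} := by
    filter_upwards [hV] with W hW
    change (violationProb P Γ Δ (θstar W) ≤ ε) = (P.real (exceedSet (faceScore X) W) ≤ ε)
    rw [hW]
  refine ⟨hmeas.nullMeasurableSet.congr hset.symm, ?_⟩
  rw [measureReal_congr hset, sub_le_comm, ← probReal_compl_eq_one_sub hmeas]
  have hcard : Fintype.card (Bool × Fin (T + 1) × Fin nx) = 2 * (T + 1) * nx := by
    simp [mul_assoc]
  let g := (Fintype.equivFinOfCardEq hcard).symm
  have hbound := pi_measure_exceedSet_gt_le (2 * (T + 1) * nx) N P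
    (fun i => faceScore X (g i)) (fun i => hfm (g i)) hε hε1
  have hcompl : {W : Fin N → E | P.real (exceedSet (faceScore X) W) ≤ ε}ᶜ =
      {W | ε < P.real (exceedSet (fun i => faceScore X (g i)) W)} := by
    ext W
    rw [mem_compl_iff]
    change ¬ P.real (exceedSet (faceScore X) W) ≤ ε ↔ ε < P.real (exceedSet (fun i => faceScore X (g i)) W)
    rw [exceedSet_comp_of_surjective _ g.surjective, not_le]
  rw [hcompl]
  exact ENNReal.toReal_le_of_le_ofReal hβ (hbound.trans (ENNReal.ofReal_le_ofReal hN))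

theorem binomialTail_zero_right {d : ℕ} (hd : 0 < d) (e c : ℝ) : binomialTail d 0 e c = 1 := by
  obtain ⟨d, rfl⟩ := Nat.exists_eq_succ_of_ne_zero hd.ne'
  simp [binomialTail, Finset.sum_range_succ']

end Reliability

/-- Reliability of the forecast envelope. -/
theorem theorem1
    {nx : ℕ} {nu : Fin 2 → ℕ} [∀ j, NeZero (nu j)] {p s : ℕ}
    (M : PredictionModel nx nu p)
    -- Gaussian posterior of the reduced parameter vector
    (m : ParamSpace p s (nu M.player))
    (S : Matrix (ParamIdx p s (nu M.player)) (ParamIdx p s (nu M.player)) ℝ)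
    (hS : S.PosSemidef)
    -- time grid `0, Δ, …, TΔ` and closed-loop map on `[0, TΔ]`
    (T : ℕ) (Δ : ℝ) (hΔ : 0 < Δ)
    (Γ : ParamSpace p s (nu M.player) → ℝ → (Fin nx → ℝ))
    (hΓ : M.IsClosedLoopMap ((T : ℝ) * Δ) (multivariateGaussian m S) Γ)
    (N : ℕ) (ε β : ℝ) (hε : ε ∈ Ioo (0 : ℝ) 1) (hβ : β ∈ Ioo (0 : ℝ) 1)
    (hN : ∑ i ∈ Finset.range (2 * (T + 1) * nx),
      (N.choose i : ℝ) * ε ^ i * (1 - ε) ^ (N - i) ≤ β) :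
    -- the scenario program has a solution for all samples
    (∀ W : Fin N → ParamSpace p s (nu M.player),
      ∃ θ : Envelope T nx, Envelope.IsMinimal (fun k => sampledRollout Γ T Δ (W k)) θ) ∧
    -- and (almost surely) solving it yields an envelope with the stated reliability
    ∀ θstar : (Fin N → ParamSpace p s (nu M.player)) → Envelope T nx,
      (∀ᵐ W ∂(Measure.pi fun _ : Fin N => multivariateGaussian m S),
        Envelope.IsMinimal (fun k => sampledRollout Γ T Δ (W k)) (θstar W)) →
      NullMeasurableSet
          {W | violationProb (multivariateGaussian m S) Γ Δ (θstar W) ≤ ε}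
          (Measure.pi fun _ : Fin N => multivariateGaussian m S) ∧
        1 - β ≤ (Measure.pi fun _ : Fin N => multivariateGaussian m S).real
          {W | violationProb (multivariateGaussian m S) Γ Δ (θstar W) ≤ ε} := by
  have hrange : (∑ i ∈ Finset.range (2 * (T + 1) * nx),
      (N.choose i : ℝ) * ε ^ i * (1 - ε) ^ (N - i)) = binomialTail (2 * (T + 1) * nx) N ε 1 := rfl
  rw [hrange] at hN
  -- For nx = 0 the tail is an empty sum, so N = 0 is possible; boxes then impose no constraint.
  rcases Nat.eq_zero_or_pos nx with rfl | hnx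
  · refine ⟨fun W => ⟨0, fun _ _ j => j.elim0, fun θ' _ => by simp [Envelope.width]⟩, ?_⟩
    intro θstar _
    have huniv : {W | violationProb (multivariateGaussian m S) Γ Δ (θstar W) ≤ ε} = univ := by
      refine eq_univ_of_forall fun W => ?_
      have hempty : {w | ∃ t, sampledRollout Γ T Δ w t ∉ Envelope.box (θstar W) t} = ∅ := by
        refine eq_empty_of_forall_notMem fun w => ?_
        rintro ⟨t, ht⟩
        exact ht fun j => j.elim0
      change Measure.real _ _ ≤ ε
      rw [hempty, measureReal_empty]
      exact hε.1.le
    rw [huniv, probReal_univ]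
    exact ⟨MeasurableSet.univ.nullMeasurableSet, by linarith [hβ.1]⟩
  -- Without samples the tail would be 1 > β.
  have hNpos : 0 < N := by
    rcases Nat.eq_zero_or_pos N with rfl | h
    · rw [binomialTail_zero_right (by positivity)] at hN
      exact absurd hβ.2 (not_lt.2 hN)
    · exact h
  have : Nonempty (Fin N) := ⟨⟨0, hNpos⟩⟩
  refine ⟨fun W => ⟨_, Envelope.isMinimal_hull⟩, fun θstar hθ => ?_⟩
  refine violationProb_reliability _ Γ Δ ?_ hε.1.le hε.2.le hN hβ.1.le θstar hθ
  refine aemeasurable_pi_lambda _ fun t => hΓ.2 _ ⟨by positivity, ?_⟩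
  have ht : ((t : ℕ) : ℝ) ≤ T := by exact_mod_cast Nat.lt_succ_iff.1 t.isLt
  exact mul_le_mul_of_nonneg_right ht hΔ.le
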